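/- A quotient Borel space $(X,E)$ is a standard Borel space $X$ together with a countable Borel equivalence relation $E$ on $X$ (that is, $E$ is Borel in $X\times X$ and all its classes are countable); its underlying set is $X/E$, and $A\subseteq X/E$ is Borel if its preimage in $X$ is Borel. A relation $R\subseteq (X,E)\times(Y,F)$, i.e. a set $R\subseteq X/E\times Y/F$, is Borel if $\{(x,y)\in X\times Y : ([x]_E,[y]_F)\in R\}$ is Borel in $X\times Y$. A function $f:X/E\to Y/F$ is a Borel function $(X,E)\to(Y,F)$ if its graph is a Borel relation. A relation $S\subseteq (X,E)\times(Y,F)$ is enumerable if $S=\bigcup_{n\in\mathbb{N}} f_n$ for some sequence of (graphs of) Borel functions $f_n:(X,E)\to(Y,F)$. Write $\operatorname{dom}R=\{x : \exists y\ (x,y)\in R\}$. A Borel uniformization of $R$ is a Borel relation $\varphi\subseteq R$ which is the graph of a partial function, with $\operatorname{dom}\varphi=\operatorname{dom}R$ and $\operatorname{dom}\varphi$ Borel in $(X,E)$. Lemma (Weak uniformization). Let $(X,E)$ and $(Y,F)$ be quotient Borel spaces and let $R\subseteq(X,E)\times(Y,F)$ be a Borel relation. If $R$ is contained in an enumerable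 relation $S$ (i.e. $R$ is covered by countably many Borel functions $(X,E)\to(Y,F)$), then $R$ has a Borel uniformization. More precisely, whenever $(f_n)_{n\in\mathbb{N}}$ is a sequence of Borel functions $(X,E)\to(Y,F)$ with $R\subseteq\bigcup_n f_n$, the relation $$\varphi_R=\{(x,y)\in R : \exists n\in\mathbb{N}\ \big((x,f_n(x))\in R,\ \forall k<n\ (x,f_k(x))\notin R,\ y=f_n(x)\big)\}$$ is a Borel uniformization of $R$. -/

import Mathlib

/-- A countable Borel equivalence relation on `X`. When `X` is a standard Borel space, the couple
`(X, E)` is a *quotient Borel space*, whose underlying set is the quotient `X / E`. -/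
structure CountableBorelEquivRel (X : Type*) [MeasurableSpace X] extends Setoid X where
  measurableSet_rel : MeasurableSet {p : X × X | toSetoid p.1 p.2}
  countable_class : ∀ x : X, {y : X | toSetoid x y}.Countable

namespace CountableBorelEquivRel

/-- The underlying set `X / E` of the quotient Borel space `(X, E)`. -/
abbrev Pts {X : Type*} [MeasurableSpace X] (E : CountableBorelEquivRel X) : Type _ :=
  Quotient E.toSetoid

/-- The quotient projection `X → X / E`. -/
def proj {X : Type*} [MeasurableSpace X] (E : CountableBorelEquivRel X) (x : X) : E.Pts :=
  Quotient.mk E.toSetoid x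

/-- A subset of `(X, E)` is Borel iff its preimage in `X` is Borel. -/
def IsBorel {X : Type*} [MeasurableSpace X] (E : CountableBorelEquivRel X) (A : Set E.Pts) : Prop :=
  MeasurableSet (E.proj ⁻¹' A)

/-- The product `(X, E) × (Y, F) = (X × Y, E × F)`. -/
def prod {X Y : Type*} [MeasurableSpace X] [MeasurableSpace Y]
    (E : CountableBorelEquivRel X) (F : CountableBorelEquivRel Y) :
    CountableBorelEquivRel (X × Y) where
  toSetoid := E.toSetoid.prod F.toSetoid
  measurableSet_rel := by
    have h1 : Measurable fun p : (X × Y) × (X × Y) => (p.1.1, p.2.1) := by fun_prop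
    have h2 : Measurable fun p : (X × Y) × (X × Y) => (p.1.2, p.2.2) := by fun_prop
    exact (h1 E.measurableSet_rel).inter (h2 F.measurableSet_rel)
  countable_class := by
    intro p
    exact (E.countable_class p.1).prod (F.countable_class p.2)

/-- A Borel binary relation `R ⊆ (X, E) × (Y, F)`: a Borel subset of the product quotient Borel
space, whose underlying set is identified with `(X / E) × (Y / F)`. -/
def IsBorelRel {X Y : Type*} [MeasurableSpace X] [MeasurableSpace Y]
    (E : CountableBorelEquivRel X) (F : CountableBorelEquivRel Y) (R : Set (E.Pts × F.Pts)) : Prop :=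
  (E.prod F).IsBorel ((Setoid.prodQuotientEquiv E.toSetoid F.toSetoid).symm ⁻¹' R)

theorem isBorelRel_iff {X Y : Type*} [MeasurableSpace X] [MeasurableSpace Y]
    (E : CountableBorelEquivRel X) (F : CountableBorelEquivRel Y) (R : Set (E.Pts × F.Pts)) :
    IsBorelRel E F R ↔ MeasurableSet {p : X × Y | (E.proj p.1, F.proj p.2) ∈ R} :=
  Iff.rfl

/-- The graph of a function `X / E → Y / F`. -/
def graph {X Y : Type*} [MeasurableSpace X] [MeasurableSpace Y]
    {E : CountableBorelEquivRel X} {F : CountableBorelEquivRel Y} (f : E.Pts → F.Pts) :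
    Set (E.Pts × F.Pts) :=
  {p | p.2 = f p.1}

/-- A function `(X, E) → (Y, F)` is Borel iff its graph is a Borel relation. -/
def IsBorelFun {X Y : Type*} [MeasurableSpace X] [MeasurableSpace Y]
    (E : CountableBorelEquivRel X) (F : CountableBorelEquivRel Y) (f : E.Pts → F.Pts) : Prop :=
  IsBorelRel E F (graph f)

/-- `S` is enumerable: it is the union of (the graphs of) countably many Borel functions
`(X, E) → (Y, F)`. -/
def IsEnumerable {X Y : Type*} [MeasurableSpace X] [MeasurableSpace Y]
    (E : CountableBorelEquivRel X) (F : CountableBorelEquivRel Y) (S : Set (E.Pts × F.Pts)) : Prop :=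
  ∃ f : ℕ → E.Pts → F.Pts, (∀ n, IsBorelFun E F (f n)) ∧ S = ⋃ n, graph (f n)

/-- The domain of a binary relation. -/
def dom {X Y : Type*} [MeasurableSpace X] [MeasurableSpace Y]
    {E : CountableBorelEquivRel X} {F : CountableBorelEquivRel Y} (R : Set (E.Pts × F.Pts)) :
    Set E.Pts :=
  {x | ∃ y, (x, y) ∈ R}

/-- `φ` is a Borel uniformization of `R`: (the graph of) a partial Borel function, with Borel domain,
which is contained in `R` and has the same domain as `R`. -/
structure IsBorelUniformization {X Y : Type*} [MeasurableSpace X] [MeasurableSpace Y]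
    (E : CountableBorelEquivRel X) (F : CountableBorelEquivRel Y)
    (R φ : Set (E.Pts × F.Pts)) : Prop where
  isBorelRel : IsBorelRel E F φ
  isBorel_dom : E.IsBorel (dom φ)
  unique : ∀ x y y', (x, y) ∈ φ → (x, y') ∈ φ → y = y'
  subset : φ ⊆ R
  dom_eq : dom φ = dom R

/-- The part of `R` obtained by choosing, for each `x`, the value `f n x` for the least `n` such that
`(x, f n x) ∈ R`. -/
def leastChoice {X Y : Type*} [MeasurableSpace X] [MeasurableSpace Y]
    {E : CountableBorelEquivRel X} {F : CountableBorelEquivRel Y}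
    (R : Set (E.Pts × F.Pts)) (f : ℕ → E.Pts → F.Pts) : Set (E.Pts × F.Pts) :=
  {p | p ∈ R ∧ ∃ n, (p.1, f n p.1) ∈ R ∧ (∀ k < n, (p.1, f k p.1) ∉ R) ∧ p.2 = f n p.1}

end CountableBorelEquivRel

namespace CountableBorelEquivRel

/-! The crux is that `{x | (x, f x) ∈ R}` is Borel. Only the graph of `f` is known to be Borel, and
no Borel lift `X → Y` is assumed, so this set cannot be obtained as a preimage under a Borel map.
Instead, it and its complement are the projections of graph ∩ `R` and graph \ `R`; both are
analytic, so Suslin's theorem applies. Since the `f n` cover `R`, its domain and the least-index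
choice are then built from such sets by countable Boolean operations. -/

/-- A set is Borel if it and its complement are both projections of Borel sets. -/
theorem measurableSet_of_image_fst {X Y : Type*} [MeasurableSpace X] [StandardBorelSpace X]
    [MeasurableSpace Y] [StandardBorelSpace Y] {A B : Set (X × Y)} {D : Set X}
    (hA : MeasurableSet A) (hB : MeasurableSet B)
    (hD : Prod.fst '' A = D) (hDc : Prod.fst '' B = Dᶜ) : MeasurableSet D := by
  let := upgradeStandardBorel X
  refine MeasureTheory.AnalyticSet.measurableSet_of_compl ?_ ?_
  · exact hD ▸ hA.analyticSet_image measurable_fst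
  · exact hDc ▸ hB.analyticSet_image measurable_fst

/-- The set of points at which the graph of a Borel function meets a Borel relation is Borel. -/
theorem isBorel_setOf_apply_mem {X Y : Type*} [MeasurableSpace X] [StandardBorelSpace X]
    [MeasurableSpace Y] [StandardBorelSpace Y]
    {E : CountableBorelEquivRel X} {F : CountableBorelEquivRel Y} {R : Set (E.Pts × F.Pts)}
    (hR : IsBorelRel E F R) {f : E.Pts → F.Pts} (hf : IsBorelFun E F f) :
    E.IsBorel {x | (x, f x) ∈ R} := by
  rw [isBorelRel_iff] at hR
  have hf' : MeasurableSet {p : X × Y | F.proj p.2 = f (E.proj p.1)} :=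
    (isBorelRel_iff E F (graph f)).1 hf
  -- Over `x`, the lifted graph is one nonempty `F`-class, and membership in `R` is constant along
  -- it. So each `x` lies in exactly one of the two projections.
  refine measurableSet_of_image_fst (hf'.inter hR) (hf'.diff hR) ?_ ?_
  all_goals
    ext x
    constructor
    · rintro ⟨⟨x, y⟩, ⟨h₁, h₂⟩, rfl⟩
      simp only [Set.mem_ofPred_eq] at h₁ h₂
      simpa [← h₁] using h₂
    · intro hx
      obtain ⟨y, hy⟩ : ∃ y, F.proj y = f (E.proj x) := Quotient.exists_rep _
      refine ⟨(x, y), ⟨hy, ?_⟩, rfl⟩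
      simpa [hy] using hx

/-- The domain of a relation covered by functions `f n` is the union of the sets on which `f n`
selects an element of the relation. -/
theorem dom_eq_iUnion {X Y : Type*} [MeasurableSpace X] [MeasurableSpace Y]
    {E : CountableBorelEquivRel X} {F : CountableBorelEquivRel Y} {R : Set (E.Pts × F.Pts)}
    {f : ℕ → E.Pts → F.Pts} (hRf : R ⊆ ⋃ n, graph (f n)) :
    dom R = ⋃ n, {x | (x, f n x) ∈ R} := by
  ext x
  simp only [Set.mem_iUnion, Set.mem_ofPred_eq]
  constructor
  · rintro ⟨y, hy⟩
    obtain ⟨n, hn⟩ := Set.mem_iUnion.1 (hRf hy)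
    obtain rfl : y = f n x := hn
    exact ⟨n, hy⟩
  · rintro ⟨n, hn⟩
    exact ⟨_, hn⟩

theorem dom_leastChoice {X Y : Type*} [MeasurableSpace X] [MeasurableSpace Y]
    {E : CountableBorelEquivRel X} {F : CountableBorelEquivRel Y} {R : Set (E.Pts × F.Pts)}
    {f : ℕ → E.Pts → F.Pts} (hRf : R ⊆ ⋃ n, graph (f n)) :
    dom (leastChoice R f) = dom R := by
  classical
  refine Set.Subset.antisymm (fun x ⟨y, hy⟩ => ⟨y, hy.1⟩) fun x hx => ?_
  rw [dom_eq_iUnion hRf] at hx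
  have hx' : ∃ n, (x, f n x) ∈ R := Set.mem_iUnion.1 hx
  exact ⟨_, Nat.find_spec hx', _, Nat.find_spec hx', fun k hk => Nat.find_min hx' hk, rfl⟩

theorem leastChoice_unique {X Y : Type*} [MeasurableSpace X] [MeasurableSpace Y]
    {E : CountableBorelEquivRel X} {F : CountableBorelEquivRel Y} {R : Set (E.Pts × F.Pts)}
    {f : ℕ → E.Pts → F.Pts} {x : E.Pts} {y y' : F.Pts}
    (hy : (x, y) ∈ leastChoice R f) (hy' : (x, y') ∈ leastChoice R f) : y = y' := by
  obtain ⟨-, n, hn, hlt, h⟩ := hy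
  obtain ⟨-, m, hm, hlt', h'⟩ := hy'
  obtain rfl : n = m :=
    le_antisymm (not_lt.1 fun h => hlt m h hm) (not_lt.1 fun h => hlt' n h hn)
  exact h.trans h'.symm

/-- Minimality of the index only tests the sets `{x | (x, f k x) ∈ R}`, pulled back to cylinders in
`X × Y`. -/
theorem isBorelRel_leastChoice {X Y : Type*} [MeasurableSpace X] [StandardBorelSpace X]
    [MeasurableSpace Y] [StandardBorelSpace Y]
    {E : CountableBorelEquivRel X} {F : CountableBorelEquivRel Y} {R : Set (E.Pts × F.Pts)}
    (hR : IsBorelRel E F R) {f : ℕ → E.Pts → F.Pts} (hf : ∀ n, IsBorelFun E F (f n)) :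
    IsBorelRel E F (leastChoice R f) := by
  have hD (n : ℕ) : MeasurableSet {p : X × Y | (E.proj p.1, f n (E.proj p.1)) ∈ R} :=
    measurable_fst (isBorel_setOf_apply_mem hR (hf n))
  have hf' (n : ℕ) : MeasurableSet {p : X × Y | F.proj p.2 = f n (E.proj p.1)} :=
    (isBorelRel_iff E F (graph (f n))).1 (hf n)
  rw [isBorelRel_iff] at hR ⊢
  convert hR.inter (.iUnion fun n =>
    (hD n).inter ((MeasurableSet.iInter fun k =>
      MeasurableSet.iInter fun _ : k < n => (hD k).compl).inter (hf' n))) using 1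
  ext p
  simp [leastChoice]

theorem isBorelUniformization_leastChoice {X Y : Type*} [MeasurableSpace X] [StandardBorelSpace X]
    [MeasurableSpace Y] [StandardBorelSpace Y]
    {E : CountableBorelEquivRel X} {F : CountableBorelEquivRel Y} {R : Set (E.Pts × F.Pts)}
    (hR : IsBorelRel E F R) {f : ℕ → E.Pts → F.Pts} (hf : ∀ n, IsBorelFun E F (f n))
    (hRf : R ⊆ ⋃ n, graph (f n)) : IsBorelUniformization E F R (leastChoice R f) where
  isBorelRel := isBorelRel_leastChoice hR hf
  isBorel_dom := by
    -- Projecting the relation itself would only give an analytic set; the cover expresses the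
    -- domain as a countable union of Borel sets.
    rw [dom_leastChoice hRf, dom_eq_iUnion hRf, IsBorel, Set.preimage_iUnion]
    exact .iUnion fun n => isBorel_setOf_apply_mem hR (hf n)
  unique _ _ _ := leastChoice_unique
  subset _ h := h.1
  dom_eq := dom_leastChoice hRf

end CountableBorelEquivRel

theorem mainTheorem11 {X Y : Type*} [MeasurableSpace X] [StandardBorelSpace X]
    [MeasurableSpace Y] [StandardBorelSpace Y]
    (E : CountableBorelEquivRel X) (F : CountableBorelEquivRel Y)
    (R : Set (E.Pts × F.Pts)) (hR : CountableBorelEquivRel.IsBorelRel E F R) :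
    ((∃ S : Set (E.Pts × F.Pts), CountableBorelEquivRel.IsEnumerable E F S ∧ R ⊆ S) →
      ∃ φ : Set (E.Pts × F.Pts), CountableBorelEquivRel.IsBorelUniformization E F R φ) ∧
    (∀ f : ℕ → E.Pts → F.Pts, (∀ n, CountableBorelEquivRel.IsBorelFun E F (f n)) →
      R ⊆ ⋃ n, CountableBorelEquivRel.graph (f n) →
      CountableBorelEquivRel.IsBorelUniformization E F R
        (CountableBorelEquivRel.leastChoice R f)) := by
  refine ⟨?_, fun f hf hRf =>
    CountableBorelEquivRel.isBorelUniformization_leastChoice hR hf hRf⟩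
  rintro ⟨_, ⟨f, hf, rfl⟩, hRf⟩
  exact ⟨_, CountableBorelEquivRel.isBorelUniformization_leastChoice hR hf hRf⟩
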